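/- There are absolute constants $c, C_1, C_2 > 0$ such that the following holds. Let $\mathcal{Z}$ be a measurable space, $\mathcal{O}$ a finite set and $n$ a natural number, and let $A : \mathcal{Z}^n \to \mathcal{O}$ be a randomized algorithm, that is, a map sending each $x \in \mathcal{Z}^n$ to a probability distribution $A(x)$ on $\mathcal{O}$ such that $x \mapsto \Pr[A(x) = o]$ is measurable for every $o \in \mathcal{O}$. Let $\varepsilon, \delta, \beta \in (0, c]$ with $$0 < \varepsilon \sqrt{n \log\tfrac{1}{\beta\delta}} \le c .$$ Suppose that $A$ is $(\varepsilon,\delta)$-item-level differentially private: for all $x, x' \in \mathcal{Z}^n$ that agree outside a single coordinate and all $S \subseteq \mathcal{O}$, $\Pr[A(x) \in S] \le e^{\varepsilon} \Pr[A(x') \in S] + \delta$. Then $A$ is $(\beta, \varepsilon', \delta')$-sample perfectly generalizing with $$\varepsilon' = C_1\, \varepsilon \sqrt{n \log\tfrac{1}{\beta\delta}}, \qquad \delta' = C_2\, n \delta ;$$ that is, for every probability distribution $\mathcal{D}$ on $\mathcal{Z}$, $$\Pr_{x, x' \sim \mathcal{D}^n}\left[ A(x) \approx_{\varepsilon', \delta'}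 A(x') \right] \ge 1 - \beta ,$$ where $x, x'$ are independent, and for distributions $P, Q$ on $\mathcal{O}$ we write $P \approx_{\varepsilon', \delta'} Q$ if both $\sum_{o \in \mathcal{O}} \max(0, P(o) - e^{\varepsilon'} Q(o)) \le \delta'$ and $\sum_{o \in \mathcal{O}} \max(0, Q(o) - e^{\varepsilon'} P(o)) \le \delta'$. -/

import Mathlib

open MeasureTheory

/-- Item-level neighbours: `x` and `x'` agree after deleting the `i`-th item, for some `i`. -/
def ItemNeighbors {Z : Type*} {n : ℕ} (x x' : Fin n → Z) : Prop :=
  ∃ i : Fin n, ∀ j : Fin n, j ≠ i → x j = x' j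

/-- The probability `Pr[o ∈ S]` for an output `o` drawn from the distribution `p` on a finite
set (where every subset is a `Finset`). -/
noncomputable def outProb {O : Type*} (p : PMF O) (S : Finset O) : ℝ :=
  ∑ o ∈ S, (p o).toReal

/-- `(ε, δ)`-item-level differential privacy. A randomized algorithm on `n` samples
is the map sending a data set to the distribution of its output. -/
def IsItemLevelDP {Z O : Type*} {n : ℕ} (A : (Fin n → Z) → PMF O) (ε δ : ℝ) : Prop :=
  ∀ x x' : Fin n → Z, ItemNeighbors x x' → ∀ S : Finset O,
    outProb (A x) S ≤ Real.exp ε * outProb (A x') S + δ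

/-- The `e^ε`-hockey stick divergence `∑ₒ [p(o) - e^ε q(o)]₊`. Summing over the whole finite
set is the same as summing over the support of `p`, since the other terms are `0`. -/
noncomputable def hockeyStick {O : Type*} [Fintype O] (ε : ℝ) (p q : PMF O) : ℝ :=
  ∑ o : O, max 0 ((p o).toReal - Real.exp ε * (q o).toReal)

/-- `p ≈_{ε, δ} q`: both hockey stick divergences are at most `δ`. -/
def Indist {O : Type*} [Fintype O] (ε δ : ℝ) (p q : PMF O) : Prop :=
  hockeyStick ε p q ≤ δ ∧ hockeyStick ε q p ≤ δ

/-- `A` is `(β, ε, δ)`-sample perfectly generalizing: for every probability distribution `D` on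
the sample space, two independent data sets `x, x' ∼ Dⁿ` satisfy `A(x) ≈_{ε, δ} A(x')` with
probability at least `1 - β`. -/
def IsSamplePerfectlyGeneralizing {Z O : Type*} [MeasurableSpace Z] [Fintype O] {n : ℕ}
    (A : (Fin n → Z) → PMF O) (β ε δ : ℝ) : Prop :=
  ∀ D : Measure Z, IsProbabilityMeasure D →
    1 - β ≤ ((Measure.pi fun _ : Fin n => D).prod (Measure.pi fun _ : Fin n => D)).real
      {w : (Fin n → Z) × (Fin n → Z) | Indist ε δ (A w.1) (A w.2)}

/-! Every `A x` is compared with one reference distribution g, the mean of `A x` over x ∼ Dⁿ. For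
pure privacy, revealing the coordinates one at a time makes A(x)(o) / g(o) a product of n likelihood
ratios, each in an interval e^{±O(ε)} and of conditional mean one. Such a product has k-th moments,
positive and inverse, of size exp(O(n k² ε²)), so it concentrates within e^{±O(ε √(n log(1/βδ)))}.

With δ > 0 the ratios can be unbounded. They are clipped to [e^{-ε}, e^ε] and divided by their mean,
which restores conditional mean one exactly and changes the distribution by O(δ) in ℓ¹ at each step
(`sum_abs_sub_mul_normalizedRatio_le`). The resulting product ρ satisfies A(x) ≈ g ρ(x), but earlier
errors get multiplied by later ratios. A worst-case bound would lose e^{2εn}; instead the total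
error is itself multiplied by averages of mean-one ratios, so its k-th moment obeys the same
estimate (`exists_tilting`).

There is no union bound over outputs: Markov's inequality is applied to the g-averages of ρ^k and
ρ^{-k} and to the k-th power of the ℓ¹ error. Taking k of order √(log(1/βδ)) / (ε √n) gives a set G
of data sets with probability at least 1 - β/2. Any two members of G are comparable through g
(`sum_max_sub_le_of_tilting`), and (1 - β/2)² ≥ 1 - β. -/

/-! ### Scalar inequalities behind the moment bounds. -/

theorem exp_le_add_exp_sq (x : ℝ) : Real.exp x ≤ x + Real.exp (x ^ 2) := by
  have h2 := Real.add_one_le_exp (x ^ 2)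
  rcases le_or_gt |x| 1 with h | h
  · have := (abs_le.1 (Real.abs_exp_sub_one_sub_id_le h)).2
    linarith
  · rcases lt_abs.1 h with h | h
    · have : Real.exp x ≤ Real.exp (x ^ 2) := Real.exp_le_exp.2 (by nlinarith)
      linarith
    · have : Real.exp x ≤ 1 := Real.exp_le_one_iff.2 (by linarith)
      nlinarith

/-- Apply e^y ≤ y + e^{y²} to y = k log r, then log r ≤ r - 1. The linear term is left in r - 1 so
that it vanishes on integration when r has mean one. -/
theorem pow_le_of_mem_Icc_exp {b r : ℝ} (k : ℕ)
    (hr : r ∈ Set.Icc (Real.exp (-b)) (Real.exp b)) :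
    r ^ k ≤ k * (r - 1) + Real.exp ((k * b) ^ 2) := by
  have h0 : 0 < r := (Real.exp_pos _).trans_le hr.1
  have h1 : -b ≤ Real.log r := (Real.le_log_iff_exp_le h0).2 hr.1
  have h2 : Real.log r ≤ b := (Real.log_le_iff_le_exp h0).2 hr.2
  have h3 : r ^ k = Real.exp (k * Real.log r) := by
    rw [Real.exp_nat_mul, Real.exp_log h0]
  have h4 : Real.exp ((k * Real.log r) ^ 2) ≤ Real.exp ((k * b) ^ 2) := by
    rw [Real.exp_le_exp, mul_pow, mul_pow]
    exact mul_le_mul_of_nonneg_left (sq_le_sq' h1 h2) (by positivity)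
  have h5 : k * Real.log r ≤ k * (r - 1) :=
    mul_le_mul_of_nonneg_left (Real.log_le_sub_one_of_pos h0) (by positivity)
  rw [h3]
  linarith [exp_le_add_exp_sq (k * Real.log r)]

/-- The bound for r⁻¹ has linear term r⁻¹ - 1, which need not integrate to zero. Replacing it by 1 -
r costs 2(cosh b - 1), which doubling the exponent absorbs. -/
theorem inv_pow_le_of_mem_Icc_exp {b r : ℝ} (k : ℕ)
    (hr : r ∈ Set.Icc (Real.exp (-b)) (Real.exp b)) :
    r⁻¹ ^ k ≤ k * (1 - r) + Real.exp (2 * (k * b) ^ 2) := by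
  have h0 : 0 < r := (Real.exp_pos _).trans_le hr.1
  have hr' : r⁻¹ ∈ Set.Icc (Real.exp (-b)) (Real.exp b) := by
    rw [Real.exp_neg]
    refine ⟨inv_anti₀ h0 hr.2, ?_⟩
    rw [← inv_inv (Real.exp b), ← Real.exp_neg]
    exact inv_anti₀ (Real.exp_pos _) hr.1
  have h1 := pow_le_of_mem_Icc_exp k hr'
  -- `r + r⁻¹ ≤ 2 cosh b`
  have hb : r + r⁻¹ ≤ Real.exp b + Real.exp (-b) := by
    have e : Real.exp b * Real.exp (-b) = 1 := by rw [← Real.exp_add]; simp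
    have h6 : 0 ≤ (r - Real.exp (-b)) * (Real.exp b - r) :=
      mul_nonneg (by linarith [hr.1]) (by linarith [hr.2])
    have h7 : r * (r + r⁻¹) ≤ r * (Real.exp b + Real.exp (-b)) := by
      rw [mul_add, mul_inv_cancel₀ h0.ne']
      nlinarith
    exact le_of_mul_le_mul_left h7 h0
  have hc : Real.exp b + Real.exp (-b) ≤ 2 * Real.exp (b ^ 2 / 2) := by
    have := Real.cosh_le_exp_half_sq b
    rw [Real.cosh_eq] at this
    linarith
  set z := Real.exp ((k * b) ^ 2 / 2) with hz
  have hz1 : 1 ≤ z := Real.one_le_exp (by positivity)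
  have hz2 : Real.exp ((k * b) ^ 2) = z ^ 2 := by
    rw [hz, ← Real.exp_nat_mul]; congr 1; push_cast; ring
  have hz4 : Real.exp (2 * (k * b) ^ 2) = z ^ 4 := by
    rw [hz, ← Real.exp_nat_mul]; congr 1; push_cast; ring
  -- Bernoulli's inequality and k ≤ k². What then remains is z² + 2(z - 1) ≤ z⁴ for z ≥ 1.
  have hB : k * (Real.exp (b ^ 2 / 2) - 1) ≤ z - 1 := by
    have h := one_add_mul_le_pow (a := Real.exp (b ^ 2 / 2) - 1)
      (by linarith [Real.exp_pos (b ^ 2 / 2)]) k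
    have h8 : (1 + (Real.exp (b ^ 2 / 2) - 1)) ^ k ≤ z := by
      rw [add_sub_cancel, ← Real.exp_nat_mul, hz, Real.exp_le_exp, mul_pow]
      have : (k : ℝ) ≤ (k : ℝ) ^ 2 := by exact_mod_cast Nat.le_self_pow two_ne_zero k
      nlinarith [sq_nonneg b]
    linarith
  have h9 : k * (r⁻¹ - 1) ≤ k * (1 - r) + k * (2 * (Real.exp (b ^ 2 / 2) - 1)) := by
    rw [← mul_add]
    exact mul_le_mul_of_nonneg_left (by linarith) (by positivity)
  have h10 : 0 ≤ (z - 1) * (z ^ 3 + z ^ 2 - 2) :=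
    mul_nonneg (by linarith) (by nlinarith [one_le_pow₀ hz1 (n := 2), one_le_pow₀ hz1 (n := 3)])
  rw [hz4]
  rw [hz2] at h1
  nlinarith

/-! ### One coordinate: clipped and normalized likelihood ratios. -/

section OneStep

variable {Z : Type*} [MeasurableSpace Z] {D : Measure Z} [IsProbabilityMeasure D]

theorem integrable_of_mem_Icc {X : Type*} [MeasurableSpace X] {μ : Measure X} [IsFiniteMeasure μ]
    {r : X → ℝ} {u v : ℝ} (hm : Measurable r) (h : ∀ x, r x ∈ Set.Icc u v) : Integrable r μ :=
  Integrable.of_mem_Icc u v hm.aemeasurable (Filter.Eventually.of_forall h)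

theorem integral_pow_le_of_mem_Icc_exp {b : ℝ} (k : ℕ) {r : Z → ℝ} (hm : Measurable r)
    (hr : ∀ z, r z ∈ Set.Icc (Real.exp (-b)) (Real.exp b)) (h1 : ∫ z, r z ∂D = 1) :
    ∫ z, r z ^ k ∂D ≤ Real.exp ((k * b) ^ 2) := by
  have hi : Integrable r D := integrable_of_mem_Icc hm hr
  calc ∫ z, r z ^ k ∂D ≤ ∫ z, (k * (r z - 1) + Real.exp ((k * b) ^ 2)) ∂D := by
        refine integral_mono_of_nonneg (Filter.Eventually.of_forall fun z => ?_) ?_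
          (Filter.Eventually.of_forall fun z => pow_le_of_mem_Icc_exp k (hr z))
        · exact pow_nonneg ((Real.exp_pos _).le.trans (hr z).1) k
        · exact ((hi.sub (integrable_const _)).const_mul _).add (integrable_const _)
    _ = _ := by
        have hj : Integrable (fun z => r z - 1) D := hi.sub (integrable_const _)
        rw [integral_add (hj.const_mul _) (integrable_const _),
          integral_const_mul, integral_sub hi (integrable_const _), h1]
        simp

theorem integral_inv_pow_le_of_mem_Icc_exp {b : ℝ} (k : ℕ) {r : Z → ℝ} (hm : Measurable r)
    (hr : ∀ z, r z ∈ Set.Icc (Real.exp (-b)) (Real.exp b)) (h1 : ∫ z, r z ∂D = 1) :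
    ∫ z, (r z)⁻¹ ^ k ∂D ≤ Real.exp (2 * (k * b) ^ 2) := by
  have hi : Integrable r D := integrable_of_mem_Icc hm hr
  calc ∫ z, (r z)⁻¹ ^ k ∂D ≤ ∫ z, (k * (1 - r z) + Real.exp (2 * (k * b) ^ 2)) ∂D := by
        refine integral_mono_of_nonneg (Filter.Eventually.of_forall fun z => ?_) ?_
          (Filter.Eventually.of_forall fun z => inv_pow_le_of_mem_Icc_exp k (hr z))
        · exact pow_nonneg (inv_nonneg.2 ((Real.exp_pos _).le.trans (hr z).1)) k
        · exact (((integrable_const _).sub hi).const_mul _).add (integrable_const _)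
    _ = _ := by
        have hj : Integrable (fun z => 1 - r z) D := (integrable_const _).sub hi
        rw [integral_add (hj.const_mul _) (integrable_const _),
          integral_const_mul, integral_sub (integrable_const _) hi, h1]
        simp

/-- The ratio `p / q` truncated to `[e^{-ε}, e^ε]`. -/
noncomputable def clippedRatio (ε p q : ℝ) : ℝ :=
  max (Real.exp (-ε)) (min (Real.exp ε) (p / q))

theorem clippedRatio_mem {ε : ℝ} (hε : 0 ≤ ε) (p q : ℝ) :
    clippedRatio ε p q ∈ Set.Icc (Real.exp (-ε)) (Real.exp ε) :=
  ⟨le_max_left _ _, max_le (Real.exp_le_exp.2 (by linarith)) (min_le_left _ _)⟩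

/-- Clipping changes p only where p > e^ε q or q > e^ε p, and there by at most the corresponding
hockey-stick excess. -/
theorem abs_sub_mul_clippedRatio_le {ε p q : ℝ} (hε : 0 ≤ ε) (hp : 0 ≤ p) (hq : 0 ≤ q) :
    |p - q * clippedRatio ε p q| ≤
      max 0 (p - Real.exp ε * q) + max 0 (q - Real.exp ε * p) := by
  have hm := clippedRatio_mem hε p q
  have hE : Real.exp ε * Real.exp (-ε) = 1 := by rw [← Real.exp_add]; simp
  have hE1 : 1 ≤ Real.exp ε := Real.one_le_exp hε
  rcases hq.eq_or_lt with rfl | hq'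
  · simp [abs_of_nonneg hp, hp]
  have hpq : q * (p / q) = p := mul_div_cancel₀ p hq'.ne'
  rcases le_total (Real.exp ε) (p / q) with h | h
  · have : clippedRatio ε p q = Real.exp ε := by
      rw [clippedRatio, min_eq_left h, max_eq_right (Real.exp_le_exp.2 (by linarith))]
    rw [this, abs_of_nonneg (by nlinarith)]
    have := le_max_right 0 (p - Real.exp ε * q)
    have := le_max_left 0 (q - Real.exp ε * p)
    linarith
  · rcases le_total (Real.exp (-ε)) (p / q) with h' | h'
    · have : clippedRatio ε p q = p / q := by
        rw [clippedRatio, min_eq_right h, max_eq_right h']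
      rw [this, hpq]
      simp only [sub_self, abs_zero]
      positivity
    · have : clippedRatio ε p q = Real.exp (-ε) := by
        rw [clippedRatio, min_eq_right h, max_eq_left h']
      have h1 : p ≤ q * Real.exp (-ε) := by
        calc p = q * (p / q) := hpq.symm
          _ ≤ _ := by gcongr
      rw [this, abs_of_nonpos (by linarith)]
      have h2 := le_max_left 0 (p - Real.exp ε * q)
      have h3 := le_max_right 0 (q - Real.exp ε * p)
      have h4 : q * Real.exp (-ε) - p ≤ q - Real.exp ε * p := by
        have : q - Real.exp ε * p = Real.exp ε * (q * Real.exp (-ε) - p) := by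
          linear_combination -q * hE
        rw [this]
        nlinarith
      linarith

variable {O : Type*} [Fintype O]

/-- The truncated likelihood ratio of `p z` against the mean of `p`, normalized to mean one. -/
noncomputable def normalizedRatio (D : Measure Z) (ε : ℝ) (p : Z → ℝ) (z : Z) : ℝ :=
  clippedRatio ε (p z) (∫ y, p y ∂D) / ∫ w, clippedRatio ε (p w) (∫ y, p y ∂D) ∂D

theorem measurable_clippedRatio {X : Type*} [MeasurableSpace X] {ε : ℝ} {p q : X → ℝ}
    (hp : Measurable p) (hq : Measurable q) : Measurable fun x => clippedRatio ε (p x) (q x) :=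
  measurable_const.max (measurable_const.min (hp.div hq))

theorem integral_clippedRatio_mem {ε : ℝ} (hε : 0 ≤ ε) {p : Z → ℝ} (hp : Measurable p) (q : ℝ) :
    ∫ w, clippedRatio ε (p w) q ∂D ∈ Set.Icc (Real.exp (-ε)) (Real.exp ε) := by
  have hi : Integrable (fun w => clippedRatio ε (p w) q) D :=
    integrable_of_mem_Icc (measurable_clippedRatio hp measurable_const)
      fun w => clippedRatio_mem hε _ _
  constructor
  · calc Real.exp (-ε) = ∫ _, Real.exp (-ε) ∂D := by simp
      _ ≤ _ := integral_mono (integrable_const _) hi fun w => (clippedRatio_mem hε _ _).1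
  · calc _ ≤ ∫ _, Real.exp ε ∂D :=
          integral_mono hi (integrable_const _) fun w => (clippedRatio_mem hε _ _).2
      _ = _ := by simp

theorem normalizedRatio_mem {ε : ℝ} (hε : 0 ≤ ε) {p : Z → ℝ} (hp : Measurable p) (z : Z) :
    normalizedRatio D ε p z ∈ Set.Icc (Real.exp (-(2 * ε))) (Real.exp (2 * ε)) := by
  have h1 := integral_clippedRatio_mem (D := D) hε hp (∫ y, p y ∂D)
  have h2 := clippedRatio_mem hε (p z) (∫ y, p y ∂D)
  have h0 := (Real.exp_pos _).trans_le h1.1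
  have e1 : Real.exp (-(2 * ε)) = Real.exp (-ε) / Real.exp ε := by
    rw [← Real.exp_sub]; congr 1; ring
  have e2 : Real.exp (2 * ε) = Real.exp ε / Real.exp (-ε) := by
    rw [← Real.exp_sub]; congr 1; ring
  rw [e1, e2]
  refine ⟨div_le_div₀ ((Real.exp_pos _).le.trans h2.1) h2.1 h0 h1.2,
    div_le_div₀ (Real.exp_pos _).le h2.2 (Real.exp_pos _) h1.1⟩

theorem integral_normalizedRatio {ε : ℝ} (hε : 0 ≤ ε) {p : Z → ℝ} (hp : Measurable p) :
    ∫ z, normalizedRatio D ε p z ∂D = 1 := by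
  have h1 := integral_clippedRatio_mem (D := D) hε hp (∫ y, p y ∂D)
  unfold normalizedRatio
  rw [integral_div, div_self ((Real.exp_pos _).trans_le h1.1).ne']

/-- Comparing p z with the mean of p costs no more than comparing it with p z', by convexity of the
positive part; this gives 2δ for clipping. The deviation of the normalizer from one is the mean
clipping error, again 2δ after weighting by q, and it is amplified by a ratio of at most e^{2ε}. -/
theorem sum_abs_sub_mul_normalizedRatio_le {ε : ℝ} (hε : 0 ≤ ε)
    {p : Z → O → ℝ} {δ : ℝ}
    (hp : ∀ o, Measurable fun z => p z o) (hp1 : ∀ z o, p z o ∈ Set.Icc (0 : ℝ) 1)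
    (hdp : ∀ z z', ∑ o, max 0 (p z o - Real.exp ε * p z' o) ≤ δ) (z : Z) :
    ∑ o, |p z o - (∫ y, p y o ∂D) * normalizedRatio D ε (fun y => p y o) z| ≤
      (2 + 2 * Real.exp (2 * ε)) * δ := by
  have hi : ∀ o, Integrable (fun z => p z o) D := fun o => integrable_of_mem_Icc (hp o) (hp1 · o)
  set q : O → ℝ := fun o => ∫ y, p y o ∂D with hq
  have hq0 : ∀ o, 0 ≤ q o := fun o => integral_nonneg fun z => (hp1 z o).1
  set C : Z → O → ℝ := fun z o => clippedRatio ε (p z o) (q o) with hC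
  set m : O → ℝ := fun o => ∫ w, C w o ∂D with hm
  have hCi : ∀ o, Integrable (fun w => C w o) D := fun o =>
    integrable_of_mem_Icc (measurable_clippedRatio (hp o) measurable_const)
      fun w => clippedRatio_mem hε _ _
  have hmI : ∀ o, m o ∈ Set.Icc (Real.exp (-ε)) (Real.exp ε) := fun o =>
    integral_clippedRatio_mem hε (hp o) _
  have hmax : ∀ c o z, Integrable (fun z' => max 0 (c * p z o - Real.exp ε * p z' o)) D :=
    fun c o z => (integrable_zero _ _ _).sup ((integrable_const _).sub ((hi o).const_mul _))
  have hmax' : ∀ o z, Integrable (fun z' => max 0 (p z' o - Real.exp ε * p z o)) D :=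
    fun o z => (integrable_zero _ _ _).sup ((hi o).sub (integrable_const _))
  -- truncation costs at most `2 δ`, at every point
  have hclip : ∀ z, ∑ o, |p z o - q o * C z o| ≤ 2 * δ := by
    intro z
    have a1 : ∑ o, max 0 (p z o - Real.exp ε * q o) ≤ δ := by
      calc ∑ o, max 0 (p z o - Real.exp ε * q o)
          ≤ ∑ o, ∫ z', max 0 (p z o - Real.exp ε * p z' o) ∂D := by
            refine Finset.sum_le_sum fun o _ => max_le (integral_nonneg fun _ => le_max_left _ _) ?_
            calc p z o - Real.exp ε * q o = ∫ z', (p z o - Real.exp ε * p z' o) ∂D := by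
                  rw [integral_sub (integrable_const _) ((hi o).const_mul _), integral_const_mul]
                  simp [hq]
              _ ≤ _ := integral_mono ((integrable_const _).sub ((hi o).const_mul _))
                  (by simpa using hmax 1 o z) fun _ => le_max_right _ _
        _ = ∫ z', ∑ o, max 0 (p z o - Real.exp ε * p z' o) ∂D :=
            (integral_finsetSum _ fun o _ => by simpa using hmax 1 o z).symm
        _ ≤ ∫ _, δ ∂D := integral_mono
            (integrable_finsetSum _ fun o _ => by simpa using hmax 1 o z)
            (integrable_const _) fun z' => hdp z z'
        _ = δ := by simp
    have a2 : ∑ o, max 0 (q o - Real.exp ε * p z o) ≤ δ := by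
      calc ∑ o, max 0 (q o - Real.exp ε * p z o)
          ≤ ∑ o, ∫ z', max 0 (p z' o - Real.exp ε * p z o) ∂D := by
            refine Finset.sum_le_sum fun o _ => max_le (integral_nonneg fun _ => le_max_left _ _) ?_
            calc q o - Real.exp ε * p z o = ∫ z', (p z' o - Real.exp ε * p z o) ∂D := by
                  rw [integral_sub (hi o) (integrable_const _)]
                  simp [hq]
              _ ≤ _ := integral_mono ((hi o).sub (integrable_const _))
                  (hmax' o z) fun _ => le_max_right _ _
        _ = ∫ z', ∑ o, max 0 (p z' o - Real.exp ε * p z o) ∂D :=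
            (integral_finsetSum _ fun o _ => hmax' o z).symm
        _ ≤ ∫ _, δ ∂D := integral_mono (integrable_finsetSum _ fun o _ => hmax' o z)
            (integrable_const _) fun z' => hdp z' z
        _ = δ := by simp
    calc ∑ o, |p z o - q o * C z o|
        ≤ ∑ o, (max 0 (p z o - Real.exp ε * q o) + max 0 (q o - Real.exp ε * p z o)) :=
          Finset.sum_le_sum fun o _ => abs_sub_mul_clippedRatio_le hε (hp1 z o).1 (hq0 o)
      _ ≤ 2 * δ := by rw [Finset.sum_add_distrib]; linarith
  have habs : ∀ o, Integrable (fun w => |p w o - q o * C w o|) D := fun o =>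
    ((hi o).sub ((hCi o).const_mul _)).abs
  have hmean : ∑ o, q o * |m o - 1| ≤ 2 * δ := by
    calc ∑ o, q o * |m o - 1| ≤ ∑ o, ∫ w, |p w o - q o * C w o| ∂D := by
          refine Finset.sum_le_sum fun o _ => ?_
          have : ∫ w, (p w o - q o * C w o) ∂D = -(q o * (m o - 1)) := by
            rw [integral_sub (hi o) ((hCi o).const_mul _), integral_const_mul]
            ring
          calc q o * |m o - 1| = |∫ w, (p w o - q o * C w o) ∂D| := by
                rw [this, abs_neg, abs_mul, abs_of_nonneg (hq0 o)]
            _ ≤ _ := abs_integral_le_integral_abs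
      _ = ∫ w, ∑ o, |p w o - q o * C w o| ∂D := (integral_finsetSum _ fun o _ => habs o).symm
      _ ≤ ∫ _, 2 * δ ∂D := integral_mono (integrable_finsetSum _ fun o _ => habs o)
          (integrable_const _) hclip
      _ = 2 * δ := by simp
  have hpt : ∀ o, |p z o - q o * normalizedRatio D ε (fun y => p y o) z| ≤
      |p z o - q o * C z o| + Real.exp (2 * ε) * (q o * |m o - 1|) := by
    intro o
    have hR := (normalizedRatio_mem (D := D) hε (hp o) z)
    have hm0 : 0 < m o := (Real.exp_pos _).trans_le (hmI o).1
    have hCR : C z o = normalizedRatio D ε (fun y => p y o) z * m o :=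
      (div_mul_cancel₀ _ hm0.ne').symm
    set R := normalizedRatio D ε (fun y => p y o) z
    calc |p z o - q o * R| = |(p z o - q o * C z o) + q o * R * (m o - 1)| := by
          rw [hCR]; congr 1; ring
      _ ≤ |p z o - q o * C z o| + |q o * R * (m o - 1)| := abs_add_le _ _
      _ ≤ _ := by
          rw [abs_mul, abs_mul, abs_of_nonneg (hq0 o),
            abs_of_nonneg ((Real.exp_pos _).le.trans hR.1)]
          have : 0 ≤ q o * |m o - 1| := mul_nonneg (hq0 o) (abs_nonneg _)
          nlinarith [hR.2]
  calc _ ≤ ∑ o, (|p z o - q o * C z o| + Real.exp (2 * ε) * (q o * |m o - 1|)) :=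
        Finset.sum_le_sum fun o _ => hpt o
    _ ≤ _ := by
        rw [Finset.sum_add_distrib, ← Finset.mul_sum]
        nlinarith [hclip z, Real.exp_pos (2 * ε)]

end OneStep

/-! ### All coordinates: the product of ratios and its moments. -/

section Tilting

variable {Z : Type*} [MeasurableSpace Z] {O : Type*} [Fintype O]

theorem measurable_finCons (n : ℕ) :
    Measurable fun w : Z × (Fin n → Z) => (Fin.cons w.1 w.2 : Fin (n + 1) → Z) := by
  rw [measurable_pi_iff]
  intro i
  refine Fin.cases ?_ (fun j => ?_) i
  · simpa using measurable_fst
  · simpa using (measurable_pi_iff.1 measurable_snd j)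

theorem integral_pi_succ (D : Measure Z) [IsProbabilityMeasure D] {n : ℕ}
    {F : (Fin (n + 1) → Z) → ℝ} (hF : Integrable F (Measure.pi fun _ => D)) :
    ∫ w, F w ∂(Measure.pi fun _ => D) =
      ∫ x, ∫ z, F (Fin.cons z x) ∂D ∂(Measure.pi fun _ : Fin n => D) := by
  have hmp := (measurePreserving_piFinSuccAbove (fun _ : Fin (n + 1) => D) 0).symm
  have he : ∀ w : Z × (Fin n → Z),
      (MeasurableEquiv.piFinSuccAbove (fun _ : Fin (n + 1) => Z) 0).symm w
        = (Fin.cons w.1 w.2 : Fin (n + 1) → Z) := fun w => by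
    simp [MeasurableEquiv.piFinSuccAbove, Fin.consEquiv]
  rw [← hmp.integral_comp']
  have hi := (hmp.integrable_comp_emb (MeasurableEquiv.measurableEmbedding _)).2 hF
  simp only [Function.comp_def, he] at hi ⊢
  exact integral_prod_symm _ hi

/-- Induction step for moments: a conditional growth factor B in the first coordinate, uniform in
the others, multiplies the full integral by B. -/
theorem integral_pi_succ_le (D : Measure Z) [IsProbabilityMeasure D] {n : ℕ}
    {F : (Fin (n + 1) → Z) → ℝ} {G : (Fin n → Z) → ℝ} {u v u' v' B : ℝ}
    (hF : Measurable F) (hFI : ∀ w, F w ∈ Set.Icc u v)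
    (hG : Measurable G) (hGI : ∀ x, G x ∈ Set.Icc u' v')
    (h : ∀ x, ∫ z, F (Fin.cons z x) ∂D ≤ B * G x) :
    ∫ w, F w ∂(Measure.pi fun _ => D) ≤ B * ∫ x, G x ∂(Measure.pi fun _ => D) := by
  have hi : Integrable (fun w : Z × (Fin n → Z) => F (Fin.cons w.1 w.2))
      (D.prod (Measure.pi fun _ => D)) :=
    integrable_of_mem_Icc (hF.comp (measurable_finCons n)) fun w => hFI _
  rw [integral_pi_succ D (integrable_of_mem_Icc hF hFI), ← integral_const_mul]
  exact integral_mono hi.integral_prod_right ((integrable_of_mem_Icc hG hGI).const_mul _) h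

theorem measurable_normalizedRatio_cons (D : Measure Z) [IsProbabilityMeasure D] (ε : ℝ) {n : ℕ}
    {f : (Fin (n + 1) → Z) → ℝ} (hf : Measurable f) :
    Measurable fun w : Fin (n + 1) → Z =>
      normalizedRatio D ε (fun z => f (Fin.cons z (Fin.tail w))) (w 0) := by
  have hfc : Measurable fun w : Z × (Fin n → Z) => f (Fin.cons w.1 w.2) :=
    hf.comp (measurable_finCons n)
  have hq : Measurable fun x : Fin n → Z => ∫ z, f (Fin.cons z x) ∂D :=
    (hfc.stronglyMeasurable.integral_prod_left (μ := D)).measurable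
  have hC : Measurable fun w : Z × (Fin n → Z) =>
      clippedRatio ε (f (Fin.cons w.1 w.2)) (∫ y, f (Fin.cons y w.2) ∂D) :=
    measurable_clippedRatio hfc (hq.comp measurable_snd)
  have hm : Measurable fun x : Fin n → Z =>
      ∫ z, clippedRatio ε (f (Fin.cons z x)) (∫ y, f (Fin.cons y x) ∂D) ∂D :=
    (hC.stronglyMeasurable.integral_prod_left (μ := D)).measurable
  have hsplit : Measurable fun w : Fin (n + 1) → Z => (w 0, Fin.tail w) :=
    (measurable_pi_apply 0).prodMk (measurable_pi_iff.2 fun i => measurable_pi_apply i.succ)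
  exact (hC.div (hm.comp measurable_snd)).comp hsplit

/-- A product of mean-one truncated likelihood ratios approximates `f`. -/
theorem exists_tilting (D : Measure Z) [IsProbabilityMeasure D] {ε δ a : ℝ} (hε : 0 ≤ ε)
    (hδ : 0 ≤ δ) (ha : 0 < a) (k : ℕ) : ∀ (n : ℕ) (f : (Fin n → Z) → O → ℝ),
    (∀ o, Measurable fun x => f x o) → (∀ x o, 0 ≤ f x o) → (∀ x, ∑ o, f x o = 1) →
    (∀ x x', ItemNeighbors x x' → ∑ o, max 0 (f x o - Real.exp ε * f x' o) ≤ δ) →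
    ∃ (g : O → ℝ) (ρ : (Fin n → Z) → O → ℝ), (∀ o, 0 ≤ g o) ∧ ∑ o, g o = 1 ∧
      (∀ o, Measurable fun x => ρ x o) ∧
      (∀ x o, ρ x o ∈ Set.Icc (Real.exp (-(n * (2 * ε)))) (Real.exp (n * (2 * ε)))) ∧
      (∀ o, ∫ x, ρ x o ^ k ∂(Measure.pi fun _ => D) ≤ Real.exp (n * (k * (2 * ε)) ^ 2)) ∧
      (∀ o, ∫ x, (ρ x o)⁻¹ ^ k ∂(Measure.pi fun _ => D) ≤
        Real.exp (n * (2 * (k * (2 * ε)) ^ 2))) ∧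
      ∫ x, (∑ o, |f x o - g o * ρ x o| + a) ^ k ∂(Measure.pi fun _ => D) ≤
        a ^ k * Real.exp (n * (k * ((2 + 2 * Real.exp (2 * ε)) * δ / a) + (k * (2 * ε)) ^ 2)) := by
  intro n
  induction n with
  | zero =>
    intro f hm h0 h1 hdp
    refine ⟨f default, fun _ _ => 1, h0 _, h1 _, fun _ => measurable_const, by simp, by simp,
      by simp, ?_⟩
    have : ∀ x : Fin 0 → Z, f x = f default := fun x => congrArg f (Subsingleton.elim _ _)
    simp [this]
  | succ n ih =>
    intro f hm h0 h1 hdp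
    have hle : ∀ x o, f x o ∈ Set.Icc (0 : ℝ) 1 := fun x o => ⟨h0 x o, by
      rw [← h1 x]; exact Finset.single_le_sum (fun i _ => h0 x i) (Finset.mem_univ o)⟩
    have hmc : ∀ o, Measurable fun w : Z × (Fin n → Z) => f (Fin.cons w.1 w.2) o := fun o =>
      (hm o).comp (measurable_finCons n)
    have hmz : ∀ x o, Measurable fun z => f (Fin.cons z x) o := fun x o =>
      (hmc o).comp (measurable_id.prodMk measurable_const)
    have hiz : ∀ x o, Integrable (fun z => f (Fin.cons z x) o) D := fun x o =>
      integrable_of_mem_Icc (hmz x o) fun z => hle _ o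
    -- Averaging out coordinate 0 preserves the privacy bound with the same ε and δ, by convexity of
    -- the positive part.
    obtain ⟨g, ρ, hg0, hg1, hρm, hρI, hρk, hρk', hρe⟩ := ih
      (fun x o => ∫ z, f (Fin.cons z x) o ∂D)
      (fun o => ((hmc o).stronglyMeasurable.integral_prod_left (μ := D)).measurable)
      (fun x o => integral_nonneg fun z => h0 _ o)
      (fun x => by rw [← integral_finsetSum _ fun o _ => hiz x o]; simp [h1])
      (fun x x' hxx' => by
        have hmax : ∀ o, Integrable
            (fun z => max 0 (f (Fin.cons z x) o - Real.exp ε * f (Fin.cons z x') o)) D :=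
          fun o => (integrable_zero _ _ _).sup ((hiz x o).sub ((hiz x' o).const_mul _))
        calc _ ≤ ∑ o, ∫ z, max 0 (f (Fin.cons z x) o - Real.exp ε * f (Fin.cons z x') o) ∂D := by
              refine Finset.sum_le_sum fun o _ =>
                max_le (integral_nonneg fun _ => le_max_left _ _) ?_
              rw [← integral_const_mul, ← integral_sub (hiz x o) ((hiz x' o).const_mul _)]
              exact integral_mono ((hiz x o).sub ((hiz x' o).const_mul _)) (hmax o)
                fun _ => le_max_right _ _
          _ = ∫ z, ∑ o, max 0 (f (Fin.cons z x) o - Real.exp ε * f (Fin.cons z x') o) ∂D :=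
              (integral_finsetSum _ fun o _ => hmax o).symm
          _ ≤ ∫ _, δ ∂D := by
              refine integral_mono (integrable_finsetSum _ fun o _ => hmax o)
                (integrable_const _) fun z => hdp _ _ ?_
              obtain ⟨i, hi⟩ := hxx'
              refine ⟨i.succ, fun j => Fin.cases (fun _ => by simp) (fun j hj => ?_) j⟩
              simpa using hi j (fun h => hj (by rw [h]))
          _ = δ := by simp)
    set R : (Fin (n + 1) → Z) → O → ℝ := fun w o =>
      normalizedRatio D ε (fun z => f (Fin.cons z (Fin.tail w)) o) (w 0) with hR
    have hRm : ∀ o, Measurable fun w => R w o := fun o =>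
      measurable_normalizedRatio_cons D ε (hm o)
    have hRI : ∀ w o, R w o ∈ Set.Icc (Real.exp (-(2 * ε))) (Real.exp (2 * ε)) := fun w o =>
      normalizedRatio_mem hε (hmz _ o) _
    have hcons : ∀ z x o, R (Fin.cons z x) o =
        normalizedRatio D ε (fun z => f (Fin.cons z x) o) z := fun z x o => by simp [hR]
    have hRmz : ∀ x o, Measurable fun z => R (Fin.cons z x) o := fun x o =>
      (hRm o).comp ((measurable_finCons n).comp (measurable_id.prodMk measurable_const))
    have hR1 : ∀ x o, ∫ z, R (Fin.cons z x) o ∂D = 1 := fun x o => by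
      simp only [hcons]; exact integral_normalizedRatio hε (hmz x o)
    have htail : Measurable fun w : Fin (n + 1) → Z => Fin.tail w :=
      measurable_pi_iff.2 fun i => measurable_pi_apply i.succ
    have hρ0 : ∀ x o, 0 < ρ x o := fun x o => (Real.exp_pos _).trans_le (hρI x o).1
    have hR0 : ∀ w o, 0 < R w o := fun w o => (Real.exp_pos _).trans_le (hRI w o).1
    have hρm' : ∀ o, Measurable fun w : Fin (n + 1) → Z => ρ (Fin.tail w) o * R w o :=
      fun o => ((hρm o).comp htail).mul (hRm o)
    have hρI' : ∀ (w : Fin (n + 1) → Z) o, ρ (Fin.tail w) o * R w o ∈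
        Set.Icc (Real.exp (-((n + 1 : ℕ) * (2 * ε)))) (Real.exp ((n + 1 : ℕ) * (2 * ε))) := by
      intro w o
      have e1 : Real.exp (-((n + 1 : ℕ) * (2 * ε))) =
          Real.exp (-(n * (2 * ε))) * Real.exp (-(2 * ε)) := by
        rw [← Real.exp_add]; congr 1; push_cast; ring
      have e2 : Real.exp ((n + 1 : ℕ) * (2 * ε)) =
          Real.exp (n * (2 * ε)) * Real.exp (2 * ε) := by
        rw [← Real.exp_add]; congr 1; push_cast; ring
      rw [e1, e2]
      exact ⟨mul_le_mul (hρI _ o).1 (hRI w o).1 (Real.exp_pos _).le (hρ0 _ o).le,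
        mul_le_mul (hρI _ o).2 (hRI w o).2 (hR0 w o).le (Real.exp_pos _).le⟩
    refine ⟨g, fun w o => ρ (Fin.tail w) o * R w o, hg0, hg1, hρm', hρI', fun o => ?_, fun o => ?_,
      ?_⟩
    · calc _ ≤ Real.exp ((k * (2 * ε)) ^ 2) * ∫ x, ρ x o ^ k ∂(Measure.pi fun _ => D) := by
            refine integral_pi_succ_le D (u := 0) (u' := 0) ((hρm' o).pow_const k)
              (fun w => ⟨pow_nonneg ((Real.exp_pos _).le.trans (hρI' w o).1) k,
                pow_le_pow_left₀ ((Real.exp_pos _).le.trans (hρI' w o).1) (hρI' w o).2 k⟩)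
              ((hρm o).pow_const k)
              (fun x => ⟨pow_nonneg (hρ0 x o).le k,
                pow_le_pow_left₀ (hρ0 x o).le (hρI x o).2 k⟩) fun x => ?_
            simp only [Fin.tail_cons, mul_pow]
            rw [integral_const_mul, mul_comm]
            exact mul_le_mul_of_nonneg_right
              (by simpa [mul_pow] using
                integral_pow_le_of_mem_Icc_exp k (hRmz x o) (fun z => hRI _ o) (hR1 x o))
              (pow_nonneg (hρ0 x o).le k)
        _ ≤ _ := by
            refine (mul_le_mul_of_nonneg_left (hρk o) (Real.exp_pos _).le).trans_eq ?_
            rw [← Real.exp_add]; congr 1; push_cast; ring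
    · calc _ ≤ Real.exp (2 * (k * (2 * ε)) ^ 2) * ∫ x, (ρ x o)⁻¹ ^ k ∂(Measure.pi fun _ => D) := by
            refine integral_pi_succ_le D (u := 0) (u' := 0) ((hρm' o).inv.pow_const k)
              (fun w => ⟨pow_nonneg (inv_nonneg.2 ((Real.exp_pos _).le.trans (hρI' w o).1)) k,
                pow_le_pow_left₀ (inv_nonneg.2 ((Real.exp_pos _).le.trans (hρI' w o).1))
                  (inv_anti₀ (Real.exp_pos _) (hρI' w o).1) k⟩)
              ((hρm o).inv.pow_const k)
              (fun x => ⟨pow_nonneg (inv_nonneg.2 (hρ0 x o).le) k,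
                pow_le_pow_left₀ (inv_nonneg.2 (hρ0 x o).le)
                  (inv_anti₀ (Real.exp_pos _) (hρI x o).1) k⟩) fun x => ?_
            simp only [Fin.tail_cons, mul_pow, mul_inv]
            rw [integral_const_mul, mul_comm]
            exact mul_le_mul_of_nonneg_right
              (by simpa [mul_pow] using
                integral_inv_pow_le_of_mem_Icc_exp k (hRmz x o) (fun z => hRI _ o) (hR1 x o))
              (pow_nonneg (inv_nonneg.2 (hρ0 x o).le) k)
        _ ≤ _ := by
            refine (mul_le_mul_of_nonneg_left (hρk' o) (Real.exp_pos _).le).trans_eq ?_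
            rw [← Real.exp_add]; congr 1; push_cast; ring
    · set κ := (2 + 2 * Real.exp (2 * ε)) * δ with hκ
      have hκ0 : 0 ≤ κ := by positivity
      set d : (Fin n → Z) → O → ℝ := fun x o => |(∫ z, f (Fin.cons z x) o ∂D) - g o * ρ x o|
        with hd
      have hd0 : ∀ x, 0 ≤ ∑ o, d x o := fun x => Finset.sum_nonneg fun o _ => abs_nonneg _
      have hdm : Measurable fun x => ∑ o, d x o :=
        Finset.measurable_sum _ fun o _ => (measurable_abs.comp
          (((hmc o).stronglyMeasurable.integral_prod_left (μ := D)).measurable.sub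
            ((hρm o).const_mul _)))
      have hg1' : ∀ o, g o ≤ 1 := fun o => by
        rw [← hg1]; exact Finset.single_le_sum (fun i _ => hg0 i) (Finset.mem_univ o)
      -- A crude bound, used only for integrability.
      have hbd : ∀ (s t r v : ℝ), 0 ≤ s → s ≤ 1 → 0 ≤ t → t ≤ 1 → 0 ≤ r → r ≤ v →
          |s - t * r| ≤ 1 + v := by
        intro s t r v hs hs1 ht ht1 hr hrv
        rw [abs_le]
        constructor <;> nlinarith
      -- error of one step
      have hstep : ∀ x z, ∑ o, |f (Fin.cons z x) o - g o * (ρ x o * R (Fin.cons z x) o)| ≤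
          ∑ o, d x o * R (Fin.cons z x) o + κ := by
        intro x z
        have hs := sum_abs_sub_mul_normalizedRatio_le (D := D) hε (p := fun z o => f (Fin.cons z x) o)
          (hmz x) (fun z o => hle _ o)
          (fun z z' => hdp _ _ ⟨0, fun j => Fin.cases (fun h => absurd rfl h)
            (fun j _ => by simp) j⟩) z
        simp only [← hcons] at hs
        -- With f̄ the average of f over coordinate 0, f - gρR = (f̄ - gρ)R + (f - f̄R): the old
        -- error is multiplied by R, and the new error sums to at most κ.
        calc _ ≤ ∑ o, (d x o * R (Fin.cons z x) o +
              |f (Fin.cons z x) o - (∫ z, f (Fin.cons z x) o ∂D) * R (Fin.cons z x) o|) := by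
              refine Finset.sum_le_sum fun o _ => ?_
              rw [hd, ← abs_of_pos (hR0 (Fin.cons z x) o), ← abs_mul,
                abs_of_pos (hR0 (Fin.cons z x) o)]
              refine (le_of_eq ?_).trans (abs_add_le _ _)
              congr 1; ring
          _ ≤ _ := by rw [Finset.sum_add_distrib]; linarith
      have hmom : ∀ x, ∫ z, (∑ o, |f (Fin.cons z x) o - g o * (ρ x o * R (Fin.cons z x) o)| + a) ^ k
          ∂D ≤ Real.exp (k * (κ / a) + (k * (2 * ε)) ^ 2) * (∑ o, d x o + a) ^ k := by
        intro x
        have hS : 0 < ∑ o, d x o + a := by linarith [hd0 x]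
        -- Growth factor of error + a before κ is added: an average of the ratios R and the constant
        -- 1, with weights d and a. Hence it lies in the same interval and has mean one.
        set r : Z → ℝ := fun z =>
          (∑ o, d x o * R (Fin.cons z x) o + a) / (∑ o, d x o + a) with hr
        have hrm : Measurable r :=
          ((Finset.measurable_sum _ fun o _ => (hRmz x o).const_mul _).add_const a).div_const _
        have hb1 : Real.exp (-(2 * ε)) ≤ 1 := Real.exp_le_one_iff.2 (by linarith)
        have hb2 : 1 ≤ Real.exp (2 * ε) := Real.one_le_exp (by linarith)
        have hrI : ∀ z, r z ∈ Set.Icc (Real.exp (-(2 * ε))) (Real.exp (2 * ε)) := by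
          intro z
          rw [hr]
          constructor
          · rw [le_div_iff₀ hS, mul_add, Finset.mul_sum]
            refine add_le_add (Finset.sum_le_sum fun o _ => ?_) (by nlinarith)
            rw [mul_comm]
            exact mul_le_mul_of_nonneg_left (hRI _ o).1 (abs_nonneg _)
          · rw [div_le_iff₀ hS, mul_add, Finset.mul_sum]
            refine add_le_add (Finset.sum_le_sum fun o _ => ?_) (by nlinarith)
            rw [mul_comm]
            exact mul_le_mul_of_nonneg_right (hRI _ o).2 (abs_nonneg _)
        have hr1 : ∫ z, r z ∂D = 1 := by
          have hi : ∀ o, Integrable (fun z => d x o * R (Fin.cons z x) o) D := fun o =>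
            (integrable_of_mem_Icc (hRmz x o) fun z => hRI _ o).const_mul _
          rw [hr, integral_div, integral_add (integrable_finsetSum _ fun o _ => hi o)
            (integrable_const _), integral_finsetSum _ fun o _ => hi o]
          simp only [integral_const_mul, hR1]
          simp [div_self hS.ne']
        have hri : Integrable (fun z => r z ^ k) D :=
          integrable_of_mem_Icc (hrm.pow_const k) (u := 0) fun z =>
            ⟨pow_nonneg ((Real.exp_pos _).le.trans (hrI z).1) k,
              pow_le_pow_left₀ ((Real.exp_pos _).le.trans (hrI z).1) (hrI z).2 k⟩
        calc _ ≤ ∫ z, (Real.exp (k * (κ / a)) * (∑ o, d x o + a) ^ k) * r z ^ k ∂D := by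
              refine integral_mono_of_nonneg (Filter.Eventually.of_forall fun z => ?_)
                (hri.const_mul _) (Filter.Eventually.of_forall fun z => ?_)
              · exact pow_nonneg (add_nonneg (Finset.sum_nonneg fun o _ => abs_nonneg _) ha.le) k
              · dsimp only
                rw [Real.exp_nat_mul, ← mul_pow, ← mul_pow]
                refine pow_le_pow_left₀
                  (add_nonneg (Finset.sum_nonneg fun o _ => abs_nonneg _) ha.le) ?_ k
                have hT : 0 ≤ ∑ o, d x o * R (Fin.cons z x) o :=
                  Finset.sum_nonneg fun o _ => mul_nonneg (abs_nonneg _) (hR0 _ o).le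
                rw [hr, mul_assoc, mul_div_cancel₀ _ hS.ne']
                -- The offset a makes the additive error multiplicative: κ ≤ (κ/a)(T + a) for T ≥ 0.
                have h3 : (κ / a + 1) * (∑ o, d x o * R (Fin.cons z x) o + a) ≤
                    Real.exp (κ / a) * (∑ o, d x o * R (Fin.cons z x) o + a) :=
                  mul_le_mul_of_nonneg_right (Real.add_one_le_exp _) (by linarith)
                have h4 : κ / a * a = κ := div_mul_cancel₀ _ ha.ne'
                have h5 : 0 ≤ κ / a * ∑ o, d x o * R (Fin.cons z x) o :=
                  mul_nonneg (div_nonneg hκ0 ha.le) hT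
                linarith [hstep x z]
          _ ≤ _ := by
              rw [integral_const_mul, Real.exp_add, mul_right_comm]
              exact mul_le_mul_of_nonneg_right
                (mul_le_mul_of_nonneg_left (integral_pow_le_of_mem_Icc_exp k hrm hrI hr1)
                  (Real.exp_pos _).le) (pow_nonneg hS.le k)
      calc _ ≤ Real.exp (k * (κ / a) + (k * (2 * ε)) ^ 2) *
            ∫ x, (∑ o, d x o + a) ^ k ∂(Measure.pi fun _ => D) := by
            refine integral_pi_succ_le D (u := 0) (u' := 0)
              (v := (∑ _o : O, (1 + Real.exp ((n + 1 : ℕ) * (2 * ε))) + a) ^ k)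
              (v' := (∑ _o : O, (1 + Real.exp (n * (2 * ε))) + a) ^ k)
              (((Finset.measurable_sum _ fun o _ => (measurable_abs.comp
                ((hm o).sub ((hρm' o).const_mul _)))).add_const a).pow_const k)
              (fun w => ⟨pow_nonneg (add_nonneg (Finset.sum_nonneg fun o _ => abs_nonneg _) ha.le) k,
                pow_le_pow_left₀ (add_nonneg (Finset.sum_nonneg fun o _ => abs_nonneg _) ha.le)
                  (add_le_add_left (Finset.sum_le_sum fun o _ => hbd _ _ _ _ (hle _ o).1
                    (hle _ o).2 (hg0 o) (hg1' o) ((Real.exp_pos _).le.trans (hρI' w o).1)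
                    (hρI' w o).2) _) k⟩)
              ((hdm.add_const a).pow_const k)
              (fun x => ⟨pow_nonneg (add_nonneg (hd0 x) ha.le) k,
                pow_le_pow_left₀ (add_nonneg (hd0 x) ha.le)
                  (add_le_add_left (Finset.sum_le_sum fun o _ => hbd _ _ _ _
                    (integral_nonneg fun z => h0 _ o) ?_
                    (hg0 o) (hg1' o) (hρ0 x o).le (hρI x o).2) _) k⟩) fun x => ?_
            · calc ∫ z, f (Fin.cons z x) o ∂D ≤ ∫ _, (1 : ℝ) ∂D :=
                    integral_mono (hiz x o) (integrable_const _) fun z => (hle _ o).2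
                _ = 1 := by simp
            · simpa only [Fin.tail_cons] using hmom x
        _ ≤ _ := by
            refine (mul_le_mul_of_nonneg_left hρe (Real.exp_pos _).le).trans_eq ?_
            rw [mul_left_comm, ← Real.exp_add]; congr 2; push_cast; ring

end Tilting

/-! ### From moments to indistinguishability on a set of high probability. -/

section Generalization

/-- The privacy inequality is applied to the event that attains the divergence, where the summand is
positive. -/
theorem IsItemLevelDP.hockeyStick_le {Z O : Type*} [Fintype O] {n : ℕ} {A : (Fin n → Z) → PMF O}
    {ε δ : ℝ} (hA : IsItemLevelDP A ε δ) {x x' : Fin n → Z} (h : ItemNeighbors x x') :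
    hockeyStick ε (A x) (A x') ≤ δ := by
  classical
  set S := Finset.univ.filter fun o => 0 < (A x o).toReal - Real.exp ε * (A x' o).toReal
  have h1 : hockeyStick ε (A x) (A x') =
      ∑ o ∈ S, ((A x o).toReal - Real.exp ε * (A x' o).toReal) := by
    rw [hockeyStick, Finset.sum_filter]
    refine Finset.sum_congr rfl fun o _ => ?_
    split_ifs with ho
    · exact max_eq_right ho.le
    · exact max_eq_left (not_lt.1 ho)
  have h2 := hA x x' h S
  rw [h1, Finset.sum_sub_distrib, ← Finset.mul_sum]
  unfold outProb at h2
  linarith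

theorem PMF.sum_toReal_eq_one {O : Type*} [Fintype O] (p : PMF O) : ∑ o, (p o).toReal = 1 := by
  rw [← ENNReal.toReal_sum fun o _ => p.apply_ne_top o, ← tsum_fintype (L := .unconditional _),
    p.tsum_coe]
  simp

theorem le_exp_mul_add_pow {s r : ℝ} (hr : 0 ≤ r) {k : ℕ} (hk : 1 ≤ k) :
    r ≤ Real.exp s + r ^ k * Real.exp (-((k - 1) * s)) := by
  rcases le_or_gt r (Real.exp s) with h | h
  · have : 0 ≤ r ^ k * Real.exp (-((k - 1) * s)) := by positivity
    linarith
  · obtain ⟨j, rfl⟩ := Nat.exists_eq_add_of_le' hk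
    have h1 : Real.exp (j * s) ≤ r ^ j := by
      rw [Real.exp_nat_mul]; exact pow_le_pow_left₀ (Real.exp_pos _).le h.le j
    have h2 : r ^ (j + 1) * Real.exp (-(((j + 1 : ℕ) - 1) * s)) ≥ r := by
      push_cast
      rw [add_sub_cancel_right, Real.exp_neg, ← div_eq_mul_inv, ge_iff_le,
        le_div_iff₀ (Real.exp_pos _), pow_succ, mul_comm]
      exact mul_le_mul_of_nonneg_right h1 hr
    linarith [Real.exp_pos s]

theorem one_le_exp_mul_add_inv_pow {s r : ℝ} (hr : 0 < r) (k : ℕ) :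
    1 ≤ Real.exp s * r + r⁻¹ ^ k * Real.exp (-(k * s)) := by
  rcases le_or_gt 1 (Real.exp s * r) with h | h
  · have : 0 ≤ r⁻¹ ^ k * Real.exp (-(k * s)) := by positivity
    linarith
  · have h1 : (Real.exp s * r) ^ k ≤ 1 := pow_le_one₀ (by positivity) h.le
    have h2 : r⁻¹ ^ k * Real.exp (-(k * s)) = ((Real.exp s * r) ^ k)⁻¹ := by
      rw [Real.exp_neg, Real.exp_nat_mul, ← inv_pow, ← mul_pow, ← inv_pow, mul_inv, mul_comm]
    have h3 : 1 ≤ ((Real.exp s * r) ^ k)⁻¹ := (one_le_inv₀ (by positivity)).2 h1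
    have : 0 < Real.exp s * r := by positivity
    linarith

/-- The chain f ≈ gρ ≲ e^s g ≲ e^{2s} gρ' ≈ e^{2s} f'. Each ≲ fails only where ρ > e^s or ρ' <
e^{-s}, and there the k-th moments pay for the excess. -/
theorem sum_max_sub_le_of_tilting {O : Type*} [Fintype O] {f f' g ρ ρ' : O → ℝ} {s δ η : ℝ} {k : ℕ}
    (hk : 1 ≤ k) (hg : ∀ o, 0 ≤ g o) (hρ : ∀ o, 0 < ρ o) (hρ' : ∀ o, 0 < ρ' o)
    (hf : ∑ o, |f o - g o * ρ o| ≤ η) (hf' : ∑ o, |f' o - g o * ρ' o| ≤ η)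
    (hup : ∑ o, g o * ρ o ^ k ≤ δ * Real.exp ((k - 1) * s))
    (hlo : ∑ o, g o * (ρ' o)⁻¹ ^ k ≤ δ * Real.exp (k * s)) :
    ∑ o, max 0 (f o - Real.exp (2 * s) * f' o) ≤
      η + δ + Real.exp s * δ + Real.exp (2 * s) * η := by
  have e2 : Real.exp (2 * s) = Real.exp s * Real.exp s := by rw [← Real.exp_add]; congr 1; ring
  have hup' : (∑ o, g o * ρ o ^ k) * Real.exp (-((k - 1) * s)) ≤ δ := by
    rw [Real.exp_neg, ← div_eq_mul_inv, div_le_iff₀ (Real.exp_pos _)]; exact hup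
  have hlo' : (∑ o, g o * (ρ' o)⁻¹ ^ k) * Real.exp (-(k * s)) ≤ δ := by
    rw [Real.exp_neg, ← div_eq_mul_inv, div_le_iff₀ (Real.exp_pos _)]; exact hlo
  calc _ ≤ ∑ o, (|f o - g o * ρ o| + g o * ρ o ^ k * Real.exp (-((k - 1) * s)) +
        Real.exp s * (g o * (ρ' o)⁻¹ ^ k * Real.exp (-(k * s))) +
        Real.exp (2 * s) * |f' o - g o * ρ' o|) := by
        refine Finset.sum_le_sum fun o _ => max_le ?_ ?_
        · have := hg o
          have := (hρ o).le
          have := (hρ' o).le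
          positivity
        · have a1 := mul_le_mul_of_nonneg_left (le_exp_mul_add_pow (s := s) (hρ o).le hk) (hg o)
          have a2 := mul_le_mul_of_nonneg_left
            (mul_le_mul_of_nonneg_left (one_le_exp_mul_add_inv_pow (s := s) (hρ' o) k) (hg o))
            (Real.exp_pos s).le
          have a3 := le_abs_self (f o - g o * ρ o)
          have a4 := mul_le_mul_of_nonneg_left (neg_abs_le (f' o - g o * ρ' o))
            (Real.exp_pos (2 * s)).le
          rw [e2] at a4 ⊢
          linarith
    _ ≤ _ := by
        rw [Finset.sum_add_distrib, Finset.sum_add_distrib, Finset.sum_add_distrib,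
          ← Finset.mul_sum, ← Finset.mul_sum, ← Finset.sum_mul, ← Finset.sum_mul]
        have := mul_le_mul_of_nonneg_left hlo' (Real.exp_pos s).le
        have := mul_le_mul_of_nonneg_left hf' (Real.exp_pos (2 * s)).le
        linarith

theorem measureReal_lt_le_of_integral_le {X : Type*} [MeasurableSpace X] {μ : Measure X}
    [IsProbabilityMeasure μ] {F : X → ℝ} (hF : Integrable F μ) (h0 : ∀ x, 0 ≤ F x) {T p : ℝ}
    (hT : 0 < T) (h : ∫ x, F x ∂μ ≤ p * T) : μ.real {x | T < F x} ≤ p := by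
  have h1 := mul_meas_ge_le_integral_of_nonneg (Filter.Eventually.of_forall h0) hF T
  have h2 : μ.real {x | T < F x} ≤ μ.real {x | T ≤ F x} :=
    measureReal_mono fun x (hx : T < F x) => hx.le
  have h3 : μ.real {x | T ≤ F x} * T ≤ p * T := by linarith
  exact h2.trans (le_of_mul_le_mul_right h3 hT)

/-- The moment exponent: of order `√(log (1 / βδ)) / (ε √n)`. -/
theorem exists_moment_exponent {N ε ℓ : ℝ} (hε : 0 < ε) (hN : 0 < N) (hℓ : 1 ≤ ℓ)
    (ht : ε * Real.sqrt (N * ℓ) ≤ 1 / 100) :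
    ∃ k : ℕ, 1 ≤ k ∧ N * (k * (2 * ε)) ^ 2 ≤ 16 * ℓ ∧ 100 * ℓ ≤ k ∧
      ℓ ≤ k * (ε * Real.sqrt (N * ℓ)) ∧ ℓ / 2 ≤ (k - 1) * (ε * Real.sqrt (N * ℓ)) := by
  set t := ε * Real.sqrt (N * ℓ) with htdef
  have ht0 : 0 < t := mul_pos hε (Real.sqrt_pos.2 (by positivity))
  have ht2 : t ^ 2 = ε ^ 2 * (N * ℓ) := by
    rw [htdef, mul_pow, Real.sq_sqrt (by positivity)]
  have h1 : 100 * ℓ ≤ ℓ / t := by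
    rw [le_div_iff₀ ht0]; nlinarith
  have h2 : ℓ / t ≤ ⌈ℓ / t⌉₊ := Nat.le_ceil _
  have h3 : (⌈ℓ / t⌉₊ : ℝ) < ℓ / t + 1 := Nat.ceil_lt_add_one (by positivity)
  -- This k balances the moment exponent N(2kε)² against the gain kt from the threshold: both have
  -- order ℓ. Rounding up keeps kt ≤ ℓ + t ≤ 2ℓ.
  set k := ⌈ℓ / t⌉₊
  have h4 : ℓ / t * t = ℓ := div_mul_cancel₀ _ ht0.ne'
  have h5 : (k : ℝ) * t ≤ 2 * ℓ := by nlinarith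
  refine ⟨k, ?_, ?_, h1.trans h2, ?_, ?_⟩
  · have : (1 : ℝ) ≤ k := by linarith
    exact_mod_cast this
  · have h6 : (k * t) ^ 2 ≤ (2 * ℓ) ^ 2 := pow_le_pow_left₀ (by positivity) h5 2
    rw [mul_pow, ht2] at h6
    have h7 : (N * (k * (2 * ε)) ^ 2) * ℓ ≤ (16 * ℓ) * ℓ := by nlinarith
    exact le_of_mul_le_mul_right h7 (by linarith)
  · nlinarith
  · nlinarith

theorem hockeyStick_le_of_tilting {O : Type*} [Fintype O] {p p' : PMF O} {g ρ ρ' : O → ℝ}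
    {s δ a : ℝ} {k : ℕ} (hδ : 0 < δ) (hδa : δ ≤ a) (hs : s ≤ 1)
    (hk : 1 ≤ k) (hg : ∀ o, 0 ≤ g o) (hρ : ∀ o, 0 < ρ o) (hρ' : ∀ o, 0 < ρ' o)
    (hf : ∑ o, |(p o).toReal - g o * ρ o| ≤ a * Real.exp 9)
    (hf' : ∑ o, |(p' o).toReal - g o * ρ' o| ≤ a * Real.exp 9)
    (hup : ∑ o, g o * ρ o ^ k ≤ δ * Real.exp ((k - 1) * s))
    (hlo : ∑ o, g o * (ρ' o)⁻¹ ^ k ≤ δ * Real.exp (k * s)) :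
    hockeyStick (2 * s) p p' ≤ Real.exp 13 * a := by
  have h := sum_max_sub_le_of_tilting hk hg hρ hρ' hf hf' hup hlo
  have ha : 0 < a := hδ.trans_le hδa
  have e1 : Real.exp (2 * s) * (a * Real.exp 9) ≤ a * Real.exp 11 := by
    rw [mul_left_comm, ← Real.exp_add]
    exact mul_le_mul_of_nonneg_left (Real.exp_le_exp.2 (by linarith)) ha.le
  have e2 : a * Real.exp 9 ≤ a * Real.exp 11 :=
    mul_le_mul_of_nonneg_left (Real.exp_le_exp.2 (by norm_num)) ha.le
  have e3 : δ ≤ a * Real.exp 11 :=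
    hδa.trans (le_mul_of_one_le_right ha.le (Real.one_le_exp (by norm_num)))
  have e4 : Real.exp s * δ ≤ a * Real.exp 11 := by
    rw [mul_comm]
    exact mul_le_mul hδa (Real.exp_le_exp.2 (by linarith)) (Real.exp_pos _).le ha.le
  -- Each of the four error terms is at most a e^{11}, and 4 ≤ e².
  have e5 : 4 * (a * Real.exp 11) ≤ Real.exp 13 * a := by
    have h13 : Real.exp 13 = Real.exp 11 * (Real.exp 1 * Real.exp 1) := by
      rw [← Real.exp_add, ← Real.exp_add]; norm_num
    have h1 : 2 ≤ Real.exp 1 := by linarith [Real.add_one_le_exp (1 : ℝ)]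
    have h2 : 4 ≤ Real.exp 1 * Real.exp 1 := by nlinarith
    rw [h13]
    nlinarith [mul_le_mul_of_nonneg_left h2 (mul_pos ha (Real.exp_pos 11)).le]
  unfold hockeyStick
  linarith

theorem exists_good_set {Z O : Type*} [MeasurableSpace Z] [Fintype O] {n : ℕ} (hn : 0 < n)
    {A : (Fin n → Z) → PMF O} (hAm : ∀ o : O, Measurable fun x => A x o) {ε δ β : ℝ}
    (hε : 0 < ε) (hε1 : ε ≤ 1 / 100) (hδ : 0 < δ) (hδ1 : δ ≤ 1 / 100) (hβ : 0 < β)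
    (hβ1 : β ≤ 1 / 100)
    (ht : ε * Real.sqrt (n * Real.log (1 / (β * δ))) ≤ 1 / 100)
    (hA : IsItemLevelDP A ε δ) (D : Measure Z) [IsProbabilityMeasure D] :
    ∃ G : Set (Fin n → Z), 1 - β / 2 ≤ (Measure.pi fun _ : Fin n => D).real G ∧
      ∀ x ∈ G, ∀ x' ∈ G, hockeyStick (72 * (ε * Real.sqrt (n * Real.log (1 / (β * δ)))))
        (A x) (A x') ≤ Real.exp 13 * (n * δ) := by
  have hβδ : 0 < β * δ := mul_pos hβ hδ
  set ℓ := Real.log (1 / (β * δ)) with hℓdef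
  have hexp : Real.exp (-ℓ) = β * δ := by
    rw [hℓdef, one_div, Real.log_inv, neg_neg, Real.exp_log hβδ]
  have hℓ : 1 ≤ ℓ := by
    rw [hℓdef, Real.le_log_iff_exp_le (by positivity), le_div_iff₀ hβδ]
    nlinarith [Real.exp_one_lt_d9]
  have hexp2 : Real.exp (-(2 * ℓ)) = (β * δ) ^ 2 := by
    rw [← hexp, ← Real.exp_nat_mul]; congr 1; push_cast; ring
  have hN : (0 : ℝ) < n := by exact_mod_cast hn
  have hN1 : (1 : ℝ) ≤ n := by exact_mod_cast hn
  obtain ⟨k, hk1, hk2, hk3, hk4, hk5⟩ := exists_moment_exponent hε hN hℓ ht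
  set t := ε * Real.sqrt (n * ℓ) with htdef
  have ht0 : 0 ≤ t := mul_nonneg hε.le (Real.sqrt_nonneg _)
  set a : ℝ := n * δ with hadef
  have ha : 0 < a := mul_pos hN hδ
  have hδa : δ ≤ a := le_mul_of_one_le_left hδ.le hN1
  have hfm : ∀ o, Measurable fun x => (A x o).toReal := fun o => (hAm o).ennreal_toReal
  obtain ⟨g, ρ, hg0, hg1, hρm, hρI, hρk, hρk', hρe⟩ := exists_tilting D hε.le hδ.le ha k n
    (fun x o => (A x o).toReal) hfm (fun x o => ENNReal.toReal_nonneg)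
    (fun x => (A x).sum_toReal_eq_one) fun x x' h => hA.hockeyStick_le h
  have hρ0 : ∀ x o, 0 < ρ x o := fun x o => (Real.exp_pos _).trans_le (hρI x o).1
  set μ : Measure (Fin n → Z) := Measure.pi fun _ => D
  have hi1 : ∀ o, Integrable (fun x => g o * ρ x o ^ k) μ := fun o =>
    (integrable_of_mem_Icc ((hρm o).pow_const k) (u := 0) fun x =>
      ⟨pow_nonneg (hρ0 x o).le k, pow_le_pow_left₀ (hρ0 x o).le (hρI x o).2 k⟩).const_mul _
  have hi2 : ∀ o, Integrable (fun x => g o * (ρ x o)⁻¹ ^ k) μ := fun o =>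
    (integrable_of_mem_Icc ((hρm o).inv.pow_const k) (u := 0) fun x =>
      ⟨pow_nonneg (inv_nonneg.2 (hρ0 x o).le) k, pow_le_pow_left₀ (inv_nonneg.2 (hρ0 x o).le)
        (inv_anti₀ (Real.exp_pos _) (hρI x o).1) k⟩).const_mul _
  have herr0 : ∀ x, 0 ≤ ∑ o, |(A x o).toReal - g o * ρ x o| := fun x =>
    Finset.sum_nonneg fun o _ => abs_nonneg _
  have hi3 : Integrable (fun x => (∑ o, |(A x o).toReal - g o * ρ x o| + a) ^ k) μ := by
    refine integrable_of_mem_Icc (u := 0)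
      (v := (∑ o, (1 + g o * Real.exp (n * (2 * ε))) + a) ^ k)
      (((Finset.measurable_sum _ fun o _ => (measurable_abs.comp
        ((hfm o).sub ((hρm o).const_mul _)))).add_const a).pow_const k) fun x =>
      ⟨pow_nonneg (add_nonneg (herr0 x) ha.le) k,
        pow_le_pow_left₀ (add_nonneg (herr0 x) ha.le)
          (add_le_add_left (Finset.sum_le_sum fun o _ => ?_) _) k⟩
    have h1 : (A x o).toReal ≤ 1 := ENNReal.toReal_le_of_le_ofReal zero_le_one
      (by simpa using (A x).coe_le_one o)
    have h2 : (0 : ℝ) ≤ (A x o).toReal := ENNReal.toReal_nonneg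
    have h3 := mul_le_mul_of_nonneg_left (hρI x o).2 (hg0 o)
    have h4 := mul_nonneg (hg0 o) (hρ0 x o).le
    rw [abs_le]
    constructor <;> linarith
  -- The factor 36 gives (k - 1) · 36t ≥ 18ℓ, which covers the moment exponent 16ℓ and the failure
  -- exponent 2ℓ. For inverse moments, k · 36t ≥ 36ℓ covers 32ℓ + 2ℓ.
  have hp1 : μ.real {x | δ * Real.exp ((k - 1) * (36 * t)) < ∑ o, g o * ρ x o ^ k} ≤
      (β * δ) ^ 2 / δ := by
    refine measureReal_lt_le_of_integral_le (integrable_finsetSum _ fun o _ => hi1 o)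
      (fun x => Finset.sum_nonneg fun o _ => mul_nonneg (hg0 o) (pow_nonneg (hρ0 x o).le k))
      (by positivity) ?_
    rw [integral_finsetSum _ fun o _ => hi1 o, ← mul_assoc, div_mul_cancel₀ _ hδ.ne', ← hexp2,
      ← Real.exp_add]
    calc _ ≤ ∑ o, g o * Real.exp (n * (k * (2 * ε)) ^ 2) := by
          refine Finset.sum_le_sum fun o _ => ?_
          rw [integral_const_mul]
          exact mul_le_mul_of_nonneg_left (hρk o) (hg0 o)
      _ ≤ _ := by
          rw [← Finset.sum_mul, hg1, one_mul, Real.exp_le_exp]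
          linarith
  have hp2 : μ.real {x | δ * Real.exp (k * (36 * t)) < ∑ o, g o * (ρ x o)⁻¹ ^ k} ≤
      (β * δ) ^ 2 / δ := by
    refine measureReal_lt_le_of_integral_le (integrable_finsetSum _ fun o _ => hi2 o)
      (fun x => Finset.sum_nonneg fun o _ =>
        mul_nonneg (hg0 o) (pow_nonneg (inv_nonneg.2 (hρ0 x o).le) k))
      (by positivity) ?_
    rw [integral_finsetSum _ fun o _ => hi2 o, ← mul_assoc, div_mul_cancel₀ _ hδ.ne', ← hexp2,
      ← Real.exp_add]
    calc _ ≤ ∑ o, g o * Real.exp (n * (2 * (k * (2 * ε)) ^ 2)) := by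
          refine Finset.sum_le_sum fun o _ => ?_
          rw [integral_const_mul]
          exact mul_le_mul_of_nonneg_left (hρk' o) (hg0 o)
      _ ≤ _ := by
          rw [← Finset.sum_mul, hg1, one_mul, Real.exp_le_exp]
          linarith
  have hp3 : μ.real {x | (a * Real.exp 9) ^ k <
      (∑ o, |(A x o).toReal - g o * ρ x o| + a) ^ k} ≤ (β * δ) ^ 2 := by
    refine measureReal_lt_le_of_integral_le hi3
      (fun x => pow_nonneg (add_nonneg (herr0 x) ha.le) k) (by positivity) (hρe.trans ?_)
    rw [← hexp2, mul_pow a, ← Real.exp_nat_mul, mul_left_comm (Real.exp _), ← Real.exp_add]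
    refine mul_le_mul_of_nonneg_left (Real.exp_le_exp.2 ?_) (by positivity)
    -- The choice a = nδ makes the n additive errors cost only 2 + 2e^{2ε} ≤ 8 per power. Then 8k +
    -- 16ℓ ≤ 9k - 2ℓ, since k ≥ 100ℓ; hence the threshold a e⁹.
    have h1 : n * (k * ((2 + 2 * Real.exp (2 * ε)) * δ / a) + (k * (2 * ε)) ^ 2) =
        k * (2 + 2 * Real.exp (2 * ε)) + n * (k * (2 * ε)) ^ 2 := by
      rw [hadef]; field_simp
    have h2 : Real.exp (2 * ε) ≤ 3 := by
      have : Real.exp (2 * ε) ≤ Real.exp 1 := Real.exp_le_exp.2 (by linarith)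
      linarith [Real.exp_one_lt_d9]
    rw [h1]
    have h3 : (k : ℝ) * (2 + 2 * Real.exp (2 * ε)) ≤ k * 8 :=
      mul_le_mul_of_nonneg_left (by linarith) (by positivity)
    linarith
  set B1 := {x | δ * Real.exp ((k - 1) * (36 * t)) < ∑ o, g o * ρ x o ^ k}
  set B2 := {x | δ * Real.exp (k * (36 * t)) < ∑ o, g o * (ρ x o)⁻¹ ^ k}
  set B3 := {x | (a * Real.exp 9) ^ k < (∑ o, |(A x o).toReal - g o * ρ x o| + a) ^ k}
  refine ⟨(B1 ∪ B2 ∪ B3)ᶜ, ?_, fun x hx x' hx' => ?_⟩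
  · have hB : μ.real (B1 ∪ B2 ∪ B3) ≤ β / 2 := by
      have e1 : (β * δ) ^ 2 / δ = β * (β * δ) := by field_simp
      have e2 : β * δ ≤ 1 / 100 := by nlinarith
      have e3 : β * (β * δ) ≤ β * (1 / 100) := mul_le_mul_of_nonneg_left e2 hβ.le
      have e4 : (β * δ) ^ 2 ≤ β * (β * δ) := by nlinarith [mul_pos hβ hβδ]
      have := measureReal_union_le (μ := μ) (B1 ∪ B2) B3
      have := measureReal_union_le (μ := μ) B1 B2
      linarith
    have h1 := measureReal_union_le (μ := μ) (B1 ∪ B2 ∪ B3) (B1 ∪ B2 ∪ B3)ᶜ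
    rw [Set.union_compl_self, probReal_univ] at h1
    linarith
  · have good : ∀ y ∈ (B1 ∪ B2 ∪ B3)ᶜ,
        (∑ o, g o * ρ y o ^ k ≤ δ * Real.exp ((k - 1) * (36 * t))) ∧
        (∑ o, g o * (ρ y o)⁻¹ ^ k ≤ δ * Real.exp (k * (36 * t))) ∧
        ∑ o, |(A y o).toReal - g o * ρ y o| ≤ a * Real.exp 9 := by
      intro y hy
      simp only [Set.mem_compl_iff, Set.mem_union, not_or] at hy
      refine ⟨not_lt.1 hy.1.1, not_lt.1 hy.1.2, ?_⟩
      have h3 : (∑ o, |(A y o).toReal - g o * ρ y o| + a) ^ k ≤ (a * Real.exp 9) ^ k :=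
        not_lt.1 hy.2
      have := le_of_pow_le_pow_left₀ (by lia) (by positivity) h3
      linarith
    have e : 72 * t = 2 * (36 * t) := by ring
    rw [e]
    exact hockeyStick_le_of_tilting hδ hδa (by linarith) hk1 hg0 (hρ0 x) (hρ0 x')
      (good x hx).2.2 (good x' hx').2.2 (good x hx).1 (good x' hx').2.1

end Generalization

theorem theorem3p3 :
    ∃ c C₁ C₂ : ℝ, 0 < c ∧ 0 < C₁ ∧ 0 < C₂ ∧
      ∀ (Z : Type*) [MeasurableSpace Z] (O : Type*) [Fintype O] (n : ℕ)
        (A : (Fin n → Z) → PMF O) (_ : ∀ o : O, Measurable fun x => A x o)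
        (ε δ β : ℝ),
        0 < ε → ε ≤ c → 0 < δ → δ ≤ c → 0 < β → β ≤ c →
        0 < ε * Real.sqrt (n * Real.log (1 / (β * δ))) →
        ε * Real.sqrt (n * Real.log (1 / (β * δ))) ≤ c →
        IsItemLevelDP A ε δ →
        IsSamplePerfectlyGeneralizing A β
          (C₁ * (ε * Real.sqrt (n * Real.log (1 / (β * δ))))) (C₂ * (n * δ)) := by
  refine ⟨1 / 100, 72, Real.exp 13, by norm_num, by norm_num, Real.exp_pos _, ?_⟩
  intro Z _ O _ n A hAm ε δ β hε hε1 hδ hδ1 hβ hβ1 ht0 ht hA D hD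
  -- For n = 0 the square root vanishes, contradicting `ht0`.
  have hn : 0 < n := by
    rcases Nat.eq_zero_or_pos n with rfl | h
    · simp at ht0
    · exact h
  obtain ⟨G, hG, hGI⟩ := exists_good_set hn hAm hε hε1 hδ hδ1 hβ hβ1 ht hA D
  calc 1 - β ≤ (Measure.pi fun _ : Fin n => D).real G * (Measure.pi fun _ : Fin n => D).real G := by
        nlinarith [mul_le_mul hG hG (by linarith) measureReal_nonneg]
    _ = ((Measure.pi fun _ : Fin n => D).prod (Measure.pi fun _ : Fin n => D)).real (G ×ˢ G) :=
        (measureReal_prod_prod G G).symm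
    _ ≤ _ := by
        refine measureReal_mono fun w hw => ?_
        exact ⟨hGI _ hw.1 _ hw.2, hGI _ hw.2 _ hw.1⟩
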